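/- All rings are associative with unity and all modules are unital right modules; $E(M)$ denotes the injective hull of $M$. An embedding is an injective homomorphism, and it is essential if its image meets every nonzero submodule of the target nontrivially. A ring $R$ is called CEP if every cyclic right $R$-module essentially embeds in a projective right $R$-module. A module $M$ is called strongly $N$-tight if, for every submodule $K$ of $N$ such that $N/K$ essentially embeds in $E(M)$, the module $N/K$ embeds in $M$. A module is uniform if it is nonzero and any two nonzero submodules of it have nonzero intersection. **Theorem.** A ring $R$ is CEP if and only if 1. $R$ is right artinian, and 2. every indecomposable projective right $R$-module is uniform and strongly $R$-tight (where $R$ is regarded as a right module over itself). -/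

import Mathlib

universe u v w

/-! The definitions are for left modules over a ring `S`.  A right module over a ring `R` is,
as usual in Mathlib, a module over `Rᵐᵒᵖ`. -/

/-- `N` is an essential submodule of `M`: it meets every nonzero submodule of `M` nontrivially. -/
def Submodule.IsEssentialIn {S : Type u} [Ring S] {M : Type v} [AddCommGroup M] [Module S M]
    (N : Submodule S M) : Prop :=
  ∀ L : Submodule S M, N ⊓ L = ⊥ → L = ⊥

/-- An essential embedding: an injective linear map with essential image. -/
def LinearMap.IsEssentialEmbedding {S : Type u} [Ring S] {M : Type v} {N : Type w}
    [AddCommGroup M] [Module S M] [AddCommGroup N] [Module S N] (f : M →ₗ[S] N) : Prop :=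
  Function.Injective f ∧ (LinearMap.range f).IsEssentialIn

/-- `M` embeds in `N`. -/
def Module.EmbedsIn (S : Type u) [Ring S] (M : Type v) (N : Type w)
    [AddCommGroup M] [Module S M] [AddCommGroup N] [Module S N] : Prop :=
  ∃ f : M →ₗ[S] N, Function.Injective f

/-- `M` essentially embeds in `N`. -/
def Module.EssentiallyEmbedsIn (S : Type u) [Ring S] (M : Type v) (N : Type w)
    [AddCommGroup M] [Module S M] [AddCommGroup N] [Module S N] : Prop :=
  ∃ f : M →ₗ[S] N, f.IsEssentialEmbedding

/-- The module `E` together with `ι : M → E` is an injective hull `E(M)` of `M`: `E` is injective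
and `ι` is an essential embedding.  (An injective hull exists, see `Module.exists_injectiveHull`,
and is unique up to an isomorphism under `M`.) -/
def Module.IsInjectiveHull {S : Type u} [Ring S] {M E : Type u}
    [AddCommGroup M] [Module S M] [AddCommGroup E] [Module S E] (ι : M →ₗ[S] E) : Prop :=
  Module.Injective S E ∧ ι.IsEssentialEmbedding

/-- Every module has an injective hull. -/
theorem Module.exists_injectiveHull (S : Type u) [Ring S] (M : Type u) [AddCommGroup M]
    [Module S M] :
    ∃ (E : Type u) (_ : AddCommGroup E) (_ : Module S E) (ι : M →ₗ[S] E),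
      Module.IsInjectiveHull ι := by
  obtain ⟨I, _, _, hI, f, hf⟩ : ∃ (I : Type u) (_ : AddCommGroup I) (_ : Module S I)
      (_ : Module.Injective S I) (f : M →ₗ[S] I), Function.Injective f := by
    let J := CategoryTheory.Injective.under (ModuleCat.of S M)
    have hJ : CategoryTheory.Injective (ModuleCat.of S J) :=
      inferInstanceAs (CategoryTheory.Injective J)
    exact ⟨J, inferInstance, inferInstance, Module.injective_module_of_injective_object S J,
      (CategoryTheory.Injective.ι (ModuleCat.of S M)).hom,
      (ModuleCat.mono_iff_injective _).1 inferInstance⟩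
  -- a maximal essential extension `N` of the image of `M` inside `I`
  let s : Set (Submodule S I) :=
    {N | LinearMap.range f ≤ N ∧ ∀ L ≤ N, LinearMap.range f ⊓ L = ⊥ → L = ⊥}
  obtain ⟨N, hMN, hN⟩ := zorn_le_nonempty₀ s (fun c hc hch y hy => by
    refine ⟨sSup c, ⟨(hc hy).1.trans (le_sSup hy), fun L hL hML => ?_⟩, fun z hz => le_sSup hz⟩
    rw [eq_bot_iff]
    intro x hx
    obtain ⟨K, hK, hxK⟩ := (Submodule.mem_sSup_of_directed ⟨y, hy⟩ hch.directedOn).1 (hL hx)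
    have h1 : Submodule.span S {x} = ⊥ := (hc hK).2 _ (by simpa using hxK) <| by
      rw [eq_bot_iff, ← hML]
      exact inf_le_inf_left _ (by simpa using hx)
    simpa using h1) (LinearMap.range f)
    ⟨le_rfl, fun L hL h => by rwa [inf_eq_right.2 hL] at h⟩
  -- a complement `C` of `N`
  obtain ⟨C, -, hC⟩ := zorn_le_nonempty₀ {C : Submodule S I | N ⊓ C = ⊥} (fun c hc hch y hy => by
    refine ⟨sSup c, ?_, fun z hz => le_sSup hz⟩
    change N ⊓ sSup c = ⊥
    rw [eq_bot_iff]
    rintro x ⟨hxN, hx⟩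
    obtain ⟨K, hK, hxK⟩ := (Submodule.mem_sSup_of_directed ⟨y, hy⟩ hch.directedOn).1 hx
    rw [← (show N ⊓ K = ⊥ from hc hK)]
    exact ⟨hxN, hxK⟩) ⊥ (by simp)
  have hNC : N ⊓ C = ⊥ := hC.1
  have hmax : ∀ L : Submodule S I, C ≤ L → N ⊓ L = ⊥ → L ≤ C := fun L h1 h2 => hC.2 h2 h1
  obtain ⟨g, hg⟩ := hI.out (C.mkQ ∘ₗ N.subtype) (by
    rw [← LinearMap.ker_eq_bot, eq_bot_iff]
    rintro ⟨x, hxN⟩ hx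
    have hxC : x ∈ C := by simpa using hx
    have : x ∈ N ⊓ C := ⟨hxN, hxC⟩
    rw [hNC] at this
    simpa using this) N.subtype
  let r : I →ₗ[S] I := g ∘ₗ C.mkQ
  have hr : ∀ x ∈ N, r x = x := fun x hx => hg ⟨x, hx⟩
  have hrC : ∀ x ∈ C, r x = 0 := fun x hx => by
    simp [r, (Submodule.Quotient.mk_eq_zero C).2 hx]
  have hNr : N ≤ LinearMap.range r := fun x hx => ⟨x, hr x hx⟩
  have hrN : LinearMap.range r ≤ N := hN.2 ⟨hN.1.1.trans hNr, fun L hL hML => by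
    have h1 : N ⊓ L = ⊥ := hN.1.2 _ inf_le_left (by
      rw [eq_bot_iff, ← hML]
      exact inf_le_inf_left _ inf_le_right)
    have h2 : L.comap r ≤ C := hmax _ (fun x hx => by simp [hrC x hx]) (by
      rw [eq_bot_iff, ← h1]
      rintro x ⟨hx, hxL⟩
      exact ⟨hx, by simpa [hr x hx] using hxL⟩)
    rw [eq_bot_iff]
    intro x hx
    obtain ⟨y, rfl⟩ := hL hx
    simpa using hrC y (h2 hx)⟩ hNr
  refine ⟨N, inferInstance, inferInstance,
    f.codRestrict N fun x => hN.1.1 ⟨x, rfl⟩, ⟨⟨?_⟩, ?_, ?_⟩⟩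
  · intro X Y _ _ _ _ i hi h
    obtain ⟨k, hk⟩ := hI.out i hi (N.subtype ∘ₗ h)
    refine ⟨(r ∘ₗ k).codRestrict N fun x => hrN ⟨k x, rfl⟩, fun x => Subtype.ext ?_⟩
    simp only [LinearMap.codRestrict_apply, LinearMap.comp_apply, hk]
    exact hr _ (h x).2
  · intro x y hxy
    exact hf (congrArg Subtype.val hxy)
  · intro L hL
    have h1 : L.map N.subtype = ⊥ := hN.1.2 _ (Submodule.map_subtype_le _ _) (by
      rw [eq_bot_iff]
      rintro _ ⟨⟨m, rfl⟩, ⟨z, hz, hzm⟩⟩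
      have h2 : z ∈ LinearMap.range (f.codRestrict N fun x => hN.1.1 ⟨x, rfl⟩) ⊓ L :=
        ⟨⟨m, Subtype.ext hzm.symm⟩, hz⟩
      rw [hL] at h2
      have h3 : z = 0 := by simpa using h2
      rw [← hzm, h3]
      simp)
    exact Submodule.map_injective_of_injective N.subtype_injective (by rw [h1, Submodule.map_bot])

/-- `M` is strongly `N`-tight: for every submodule `K` of `N`, if `N ⧸ K` essentially embeds in
the injective hull `E(M)`, then `N ⧸ K` embeds in `M`. -/
def Module.IsStronglyTight (S : Type u) [Ring S] (N M : Type u)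
    [AddCommGroup N] [Module S N] [AddCommGroup M] [Module S M] : Prop :=
  ∀ (E : Type u) [AddCommGroup E] [Module S E] (ι : M →ₗ[S] E), Module.IsInjectiveHull ι →
    ∀ K : Submodule S N, Module.EssentiallyEmbedsIn S (N ⧸ K) E → Module.EmbedsIn S (N ⧸ K) M

/-- A uniform module: nonzero, and every two nonzero submodules intersect nontrivially. -/
def Module.IsUniform (S : Type u) [Ring S] (M : Type v) [AddCommGroup M] [Module S M] : Prop :=
  Nontrivial M ∧ ∀ A B : Submodule S M, A ⊓ B = ⊥ → A = ⊥ ∨ B = ⊥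

/-- An indecomposable module: nonzero, and not the internal direct sum of two nonzero
submodules. -/
def Module.IsIndecomposable (S : Type u) [Ring S] (M : Type v) [AddCommGroup M] [Module S M] :
    Prop :=
  Nontrivial M ∧ ∀ A B : Submodule S M, IsCompl A B → A = ⊥ ∨ B = ⊥

/-- A cyclic module: generated by one element. -/
def Module.IsCyclicModule (S : Type u) [Ring S] (M : Type v) [AddCommGroup M] [Module S M] :
    Prop :=
  ∃ x : M, Submodule.span S {x} = ⊤

/-- `R` is a (right) CEP ring: every cyclic right `R`-module essentially embeds in a projective
right `R`-module. -/
def IsCEPRing (R : Type u) [Ring R] : Prop :=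
  ∀ (C : Type u) [AddCommGroup C] [Module Rᵐᵒᵖ C], Module.IsCyclicModule Rᵐᵒᵖ C →
    ∃ (P : Type u) (_ : AddCommGroup P) (_ : Module Rᵐᵒᵖ P),
      Module.Projective Rᵐᵒᵖ P ∧ Module.EssentiallyEmbedsIn Rᵐᵒᵖ C P

/-! The argument runs over left modules for `S = Rᵐᵒᵖ`.

Suppose cyclic modules embed essentially in projectives. The key is to control simple quotients of
projectives by their socles. If `Q` is projective with an essential cyclic submodule, the elements
of `Q` killed by the relevant homogeneous parts of the socle of `S` form a proper submodule, and a
relative form of Bass's theorem puts it inside a maximal one. Projectives with sufficiently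
different socles thus get nonisomorphic simple quotients (`exists_injective_simpleType`). If the set
of simple types were infinite, an independent family of its subsets, one for each subset, would
occur as socles and contradict Cantor's theorem. So there are finitely many simples, and the
projectives `P i` with essential simple socle of type `i` have every simple as a quotient, by
counting. Hence the `P i` generate, every cyclic module embeds in a finite product of them, and `S`
is artinian. By Fitting's lemma the `P i` are all the indecomposable projectives, and the socle
determines which one; this gives uniformity and tightness.

Conversely, over an artinian ring each simple is a quotient of an indecomposable projective.
Tightness makes the map from this simple to the simple socle injective, hence a permutation of the
finite set of simples. So every simple lies in an indecomposable projective, tightness makes maps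
into these separate the points of a cyclic module, and a minimal separating family is an essential
embedding. -/

/-! ### Essential submodules and uniform modules. -/

section Essential

variable {S : Type u} [Ring S] {M : Type v} {N : Type w} [AddCommGroup M] [AddCommGroup N]
  [Module S M] [Module S N]

namespace Submodule

theorem IsEssentialIn.mono {A B : Submodule S M} (h : A.IsEssentialIn) (hAB : A ≤ B) :
    B.IsEssentialIn :=
  fun L hL => h L (eq_bot_iff.2 ((inf_le_inf_right L hAB).trans hL.le))

theorem IsEssentialIn.comap {B : Submodule S N} (h : B.IsEssentialIn) (f : M →ₗ[S] N) :
    (B.comap f).IsEssentialIn := by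
  intro L hL
  have h1 : L.map f = ⊥ := h _ (by
    rw [eq_bot_iff]
    rintro _ ⟨hy, x, hx, rfl⟩
    have : x ∈ B.comap f ⊓ L := ⟨hy, hx⟩
    rw [hL, Submodule.mem_bot] at this
    simp [this])
  rw [eq_bot_iff, ← hL]
  refine le_inf (fun x hx => ?_) le_rfl
  have : f x ∈ L.map f := ⟨x, hx, rfl⟩
  rw [h1, Submodule.mem_bot] at this
  simp [this]

theorem IsEssentialIn.inf {A B : Submodule S M} (hA : A.IsEssentialIn) (hB : B.IsEssentialIn) :
    (A ⊓ B).IsEssentialIn :=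
  fun L hL => hB L (hA _ (by rwa [← inf_assoc]))

theorem isEssentialIn_finset_inf {ι : Type*} (s : Finset ι) (A : ι → Submodule S M)
    (h : ∀ i ∈ s, (A i).IsEssentialIn) : (s.inf A).IsEssentialIn := by
  classical
  induction s using Finset.induction_on with
  | empty => intro L hL; simpa using hL
  | insert i s _ ih =>
    rw [Finset.inf_insert]
    exact (h i (by simp)).inf (ih fun j hj => h j (by simp [hj]))

/-- The product is a finite intersection of preimages under the projections, and both operations
preserve essentiality. -/
theorem isEssentialIn_pi {ι : Type*} [Fintype ι] {X : ι → Type*} [∀ i, AddCommGroup (X i)]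
    [∀ i, Module S (X i)] (A : ∀ i, Submodule S (X i)) (h : ∀ i, (A i).IsEssentialIn) :
    (Submodule.pi Set.univ A).IsEssentialIn := by
  refine (isEssentialIn_finset_inf Finset.univ
    (fun i => (A i).comap (LinearMap.proj i)) fun i _ => (h i).comap _).mono fun x hx => ?_
  simpa [Submodule.mem_finsetInf] using hx

theorem IsEssentialIn.exists_mem {A L : Submodule S M} (h : A.IsEssentialIn) (hL : L ≠ ⊥) :
    ∃ x ∈ A, x ∈ L ∧ x ≠ 0 := by
  by_contra! hc
  exact hL (h L (eq_bot_iff.2 fun x hx => hc x hx.1 hx.2))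

end Submodule

open Submodule

theorem LinearMap.injective_of_isEssentialIn {A : Submodule S M} (hA : A.IsEssentialIn)
    (f : M →ₗ[S] N) (hf : ∀ x ∈ A, f x = 0 → x = 0) : Function.Injective f := by
  rw [← LinearMap.ker_eq_bot]
  exact hA _ (eq_bot_iff.2 fun x hx => hf x hx.1 hx.2)

theorem Module.IsUniform.isEssentialIn (h : Module.IsUniform S M) {A : Submodule S M}
    (hA : A ≠ ⊥) : A.IsEssentialIn :=
  fun L hL => (h.2 A L hL).resolve_left hA

theorem Module.IsUniform.of_injective (h : Module.IsUniform S N) [Nontrivial M] (f : M →ₗ[S] N)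
    (hf : Function.Injective f) : Module.IsUniform S M := by
  refine ⟨inferInstance, fun A B hAB => ?_⟩
  have := h.2 (A.map f) (B.map f) (by rw [← Submodule.map_inf f hf, hAB, Submodule.map_bot])
  exact this.imp
    (fun h => Submodule.map_injective_of_injective hf (h.trans (Submodule.map_bot f).symm))
    fun h => Submodule.map_injective_of_injective hf (h.trans (Submodule.map_bot f).symm)

theorem Module.IsUniform.of_essential (h : Module.IsUniform S M) (f : M →ₗ[S] N)
    (hf : f.IsEssentialEmbedding) : Module.IsUniform S N := by
  have := h.1
  refine ⟨hf.1.nontrivial, fun A B hAB => ?_⟩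
  have h1 := h.2 (A.comap f) (B.comap f) (by
    rw [← Submodule.comap_inf, hAB, ← LinearMap.ker_eq_bot.2 hf.1]; rfl)
  have key : ∀ C : Submodule S N, C.comap f = ⊥ → C = ⊥ := fun C hC => hf.2 C (by
    rw [eq_bot_iff]
    rintro _ ⟨⟨x, rfl⟩, hx⟩
    have : x ∈ C.comap f := hx
    rw [hC, Submodule.mem_bot] at this
    simp [this])
  exact h1.imp (key A) (key B)

theorem Module.IsUniform.isIndecomposable (h : Module.IsUniform S M) :
    Module.IsIndecomposable S M :=
  ⟨h.1, fun A B hAB => h.2 A B hAB.inf_eq_bot⟩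

theorem Module.IsUniform.of_isSimpleModule [IsSimpleModule S M] : Module.IsUniform S M := by
  refine ⟨IsSimpleModule.nontrivial S M, fun A B hAB => ?_⟩
  rcases eq_bot_or_eq_top A with h | h
  · exact Or.inl h
  · subst h; exact Or.inr (by simpa using hAB)

theorem Submodule.exists_maximal_inf_eq_bot (A : Submodule S M) :
    ∃ I : Submodule S M, Maximal (fun I => I ⊓ A = ⊥) I := by
  obtain ⟨I, -, hI⟩ := zorn_le_nonempty₀ {I : Submodule S M | I ⊓ A = ⊥} (fun c hc hch y hy => by
    refine ⟨sSup c, ?_, fun z hz => le_sSup hz⟩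
    change sSup c ⊓ A = ⊥
    rw [eq_bot_iff]
    rintro x ⟨hx, hxA⟩
    obtain ⟨K, hK, hxK⟩ := (Submodule.mem_sSup_of_directed ⟨y, hy⟩ hch.directedOn).1 hx
    rw [← (show K ⊓ A = ⊥ from hc hK)]
    exact ⟨hxK, hxA⟩) ⊥ (by simp)
  exact ⟨I, hI⟩

end Essential

/-! ### Maximal submodules of projective modules. -/

section Bass

variable {S : Type u} [Ring S]

/-- Modulo `I` the matrix `1 - A` is invertible, and it annihilates `r`. This is Nakayama's argument
in matrix form. -/
theorem Ideal.mem_of_vecMul_eq {n : Type*} [Fintype n] [DecidableEq n] (I : Ideal S)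
    [I.IsTwoSided] (A : Matrix n n S) (hA : ∀ i j, A i j ∈ I.jacobson) (r : n → S)
    (hr : Matrix.vecMul r A = r) (k : n) : r k ∈ I := by
  have hA' : A ∈ (I.matrix n).jacobson :=
    Ideal.matrix_jacobson_le I (fun i j => hA i j)
  have hmul : ∀ B C : Matrix n n S, B ∈ I.matrix n → B * C ∈ I.matrix n := fun B C hB i j =>
    I.sum_mem fun l _ => I.mul_mem_right _ (hB i l)
  -- Modulo `I`, `z` is a left inverse of `1 - A`, so `z = 1 + zA` has a left inverse `w` too. Then
  -- `w = 1 - A`, and `z` is also a right inverse.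
  obtain ⟨z, hz⟩ := Ideal.mem_jacobson_iff.1 hA' (-1)
  obtain ⟨w, hw⟩ := Ideal.mem_jacobson_iff.1 (Ideal.mul_mem_left _ z hA') 1
  have h1 : w * z - 1 ∈ I.matrix n := by
    have := add_mem hw (Ideal.mul_mem_left _ w hz)
    convert this using 1; noncomm_ring
  have h2 : (1 - A) - w ∈ I.matrix n := by
    have := sub_mem (Ideal.mul_mem_left _ w hz) (hmul _ (1 - A) h1)
    convert this using 1; noncomm_ring
  have h3 : (1 - A) * z - 1 ∈ I.matrix n := by
    have := add_mem (hmul _ z h2) h1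
    convert this using 1; noncomm_ring
  have h4 : Matrix.vecMul r ((1 - A) * z - 1) = -r := by
    rw [Matrix.vecMul_sub, ← Matrix.vecMul_vecMul, Matrix.vecMul_sub, hr]
    simp
  have h5 : r k = -Matrix.vecMul r ((1 - A) * z - 1) k := by rw [h4]; simp
  rw [h5]
  exact I.neg_mem (I.sum_mem fun l _ => I.mul_mem_left _ (h3 l k))

/-- A relative form of the theorem of Bass that a nonzero projective module has a maximal
submodule. -/
theorem Module.Projective.exists_isCoatom_ge {Q : Type v} [AddCommGroup Q] [Module S Q]
    [Module.Projective S Q] (N : Submodule S Q) (I : Ideal S) [I.IsTwoSided]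
    (hNI : ∀ (φ : Q →ₗ[S] S), ∀ x ∈ N, φ x ∈ I) (hIN : ∀ a ∈ I, ∀ q : Q, a • q ∈ N)
    (hN : N ≠ ⊤) : ∃ M, IsCoatom M ∧ N ≤ M := by
  classical
  by_contra! hc
  -- If `φ q` missed a maximal left ideal `m ≥ I`, the kernel of `Q → S ⧸ m` would be a maximal
  -- submodule containing `N`.
  have hjac : ∀ (φ : Q →ₗ[S] S) (q : Q), φ q ∈ I.jacobson := by
    intro φ q
    rw [Ideal.jacobson, Submodule.mem_sInf]
    rintro m ⟨hIm, hm⟩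
    by_contra hq
    have : IsSimpleModule S (S ⧸ m) := isSimpleModule_iff_isCoatom.2 hm.out
    have hne : m.mkQ ∘ₗ φ ≠ 0 := fun h0 => hq (by
      have := LinearMap.congr_fun h0 q
      simpa [Submodule.Quotient.mk_eq_zero] using this)
    refine hc _ (LinearMap.isCoatom_ker_of_surjective
      (LinearMap.surjective_of_ne_zero hne)) fun x hx => ?_
    simpa using (Submodule.Quotient.mk_eq_zero m).2 (hIm (hNI φ x hx))
  obtain ⟨s, hs⟩ :=
    Module.projective_def'.1 (inferInstance : Module.Projective S Q)
  refine hN (eq_top_iff.2 fun x _ => ?_)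
  have hx : ∀ y : Q, (s y).sum (fun q a => a • q) = y := fun y => by
    have := LinearMap.congr_fun hs y
    simpa [Finsupp.linearCombination_apply] using this
  let G := (s x).support
  let φ : Q → (Q →ₗ[S] S) := fun q => Finsupp.lapply q ∘ₗ s
  have hxG : ∑ q ∈ G, φ q x • q = x := hx x
  -- Applying the coordinates `φ k` to `x = ∑ φ q x • q` shows that the coordinate vector of `x` is
  -- fixed by this matrix.
  have hr : ∀ k : G, φ k x ∈ I := Ideal.mem_of_vecMul_eq I (fun j k : G => φ k (j : Q))
    (fun i j => hjac _ _) (fun j : G => φ j x) (by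
      ext k
      simp only [Matrix.vecMul, dotProduct]
      conv_rhs => rw [← hxG]
      rw [map_sum, ← Finset.sum_coe_sort G]
      simp)
  rw [← hxG]
  exact N.sum_mem fun q hq => hIN _ (hr ⟨q, hq⟩) q

theorem Module.Projective.exists_isCoatom {Q : Type v} [AddCommGroup Q] [Module S Q]
    [Module.Projective S Q] [Nontrivial Q] : ∃ M : Submodule S Q, IsCoatom M := by
  obtain ⟨M, hM, -⟩ := Module.Projective.exists_isCoatom_ge (⊥ : Submodule S Q) (⊥ : Ideal S)
    (by simp) (by simp) bot_ne_top
  exact ⟨M, hM⟩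

end Bass

/-! ### Simple types, socles and negligible elements. -/

section SimpleType

variable (S : Type u) [Ring S]

/-- Two maximal left ideals are equivalent if the simple quotients are isomorphic. -/
def simpleTypeSetoid : Setoid {m : Submodule S S // IsCoatom m} where
  r m n := Nonempty ((S ⧸ m.1) ≃ₗ[S] (S ⧸ n.1))
  iseqv := ⟨fun _ => ⟨LinearEquiv.refl _ _⟩, fun ⟨e⟩ => ⟨e.symm⟩, fun ⟨e⟩ ⟨f⟩ => ⟨e.trans f⟩⟩

/-- The isomorphism classes of simple modules. -/
def SimpleType : Type u := Quotient (simpleTypeSetoid S)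

variable {S}

/-- A simple module representing an isomorphism class. -/
abbrev SimpleType.Carrier (i : SimpleType S) : Type u := S ⧸ (Quotient.out i).1

instance (i : SimpleType S) : IsSimpleModule S i.Carrier :=
  isSimpleModule_iff_isCoatom.2 (Quotient.out i).2

theorem SimpleType.eq_of_linearEquiv {i j : SimpleType S} (e : i.Carrier ≃ₗ[S] j.Carrier) :
    i = j :=
  Quotient.out_equiv_out.1 ⟨e⟩

theorem SimpleType.exists_linearEquiv (T : Type v) [AddCommGroup T] [Module S T]
    [IsSimpleModule S T] : ∃ i : SimpleType S, Nonempty (T ≃ₗ[S] i.Carrier) := by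
  obtain ⟨I, hI, ⟨e⟩⟩ := isSimpleModule_iff_quot_maximal.1 (inferInstance : IsSimpleModule S T)
  let m : {m : Submodule S S // IsCoatom m} := ⟨I, hI.out⟩
  have h : (simpleTypeSetoid S).r m (Quotient.out (Quotient.mk (simpleTypeSetoid S) m)) :=
    (simpleTypeSetoid S).symm (Quotient.mk_out (s := simpleTypeSetoid S) m)
  exact ⟨Quotient.mk (simpleTypeSetoid S) m, h.map fun f => e.trans f⟩

theorem SimpleType.eq_of_ne_zero {i j : SimpleType S} (g : i.Carrier →ₗ[S] j.Carrier)
    (hg : g ≠ 0) : i = j :=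
  SimpleType.eq_of_linearEquiv (LinearEquiv.ofBijective g (g.bijective_of_ne_zero hg))

/-- The isomorphism classes of the simple submodules of a module. -/
def simpleTypes (X : Type v) [AddCommGroup X] [Module S X] : Set (SimpleType S) :=
  {i | ∃ g : i.Carrier →ₗ[S] X, g ≠ 0}

theorem LinearMap.range_eq_span_of_ne_zero {T : Type w} {X : Type v} [AddCommGroup T] [Module S T]
    [AddCommGroup X] [Module S X] [IsSimpleModule S T] (g : T →ₗ[S] X) {t : T} (ht : t ≠ 0) :
    LinearMap.range g = Submodule.span S {g t} := by
  rw [LinearMap.range_eq_map, ← IsSimpleModule.span_singleton_eq_top S ht, Submodule.map_span,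
    Set.image_singleton]

variable {X : Type v} {Y : Type w} [AddCommGroup X] [Module S X] [AddCommGroup Y] [Module S Y]

theorem simpleTypes_mono (f : X →ₗ[S] Y) (hf : Function.Injective f) :
    simpleTypes (S := S) X ⊆ simpleTypes Y := by
  rintro i ⟨g, hg⟩
  refine ⟨f ∘ₗ g, fun h => hg (LinearMap.ext fun t => hf ?_)⟩
  simpa using LinearMap.congr_fun h t

theorem simpleTypes_eq_of_isEssentialEmbedding (f : X →ₗ[S] Y) (hf : f.IsEssentialEmbedding) :
    simpleTypes (S := S) X = simpleTypes Y := by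
  refine (simpleTypes_mono f hf.1).antisymm ?_
  rintro i ⟨g, hg⟩
  obtain ⟨_, hy, ⟨t, rfl⟩, hy0⟩ := hf.2.exists_mem (mt LinearMap.range_eq_bot.1 hg)
  have ht : t ≠ 0 := by rintro rfl; simp at hy0
  have hle : LinearMap.range g ≤ LinearMap.range f := by
    rwa [LinearMap.range_eq_span_of_ne_zero g ht, Submodule.span_singleton_le_iff_mem]
  let e := LinearEquiv.ofInjective f hf.1
  refine ⟨e.symm.toLinearMap ∘ₗ g.codRestrict _ fun t => hle ⟨t, rfl⟩, fun h0 => hy0 ?_⟩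
  have h1 := LinearMap.congr_fun h0 t
  simp only [LinearMap.comp_apply, LinearEquiv.coe_coe, LinearMap.zero_apply,
    LinearEquiv.map_eq_zero_iff] at h1
  exact congrArg Subtype.val h1

theorem SimpleType.simpleTypes_carrier (i : SimpleType S) :
    simpleTypes (S := S) i.Carrier = {i} := by
  ext j
  refine ⟨fun ⟨g, hg⟩ => SimpleType.eq_of_ne_zero g hg, ?_⟩
  rintro rfl
  refine ⟨LinearMap.id, fun h0 => ?_⟩
  obtain ⟨x, hx⟩ := @exists_ne _ (IsSimpleModule.nontrivial S j.Carrier) 0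
  exact hx (LinearMap.congr_fun h0 x)

theorem SimpleType.eq_of_range_le {i j : SimpleType S} (g : i.Carrier →ₗ[S] X)
    (h : j.Carrier →ₗ[S] X) (hh : h ≠ 0) (hle : LinearMap.range h ≤ LinearMap.range g) :
    i = j := by
  have hg : Function.Injective g := LinearMap.injective_of_ne_zero fun h0 => hh (by
    rw [h0, LinearMap.range_zero, le_bot_iff, LinearMap.range_eq_bot] at hle
    exact hle)
  let e := LinearEquiv.ofInjective g hg
  let k : j.Carrier →ₗ[S] i.Carrier :=
    e.symm.toLinearMap ∘ₗ h.codRestrict _ fun t => hle ⟨t, rfl⟩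
  refine (SimpleType.eq_of_ne_zero k fun h0 => hh (LinearMap.ext fun t => ?_)).symm
  have h1 : k t = 0 := LinearMap.congr_fun h0 t
  simp only [k, LinearMap.comp_apply, LinearEquiv.coe_coe, LinearEquiv.map_eq_zero_iff] at h1
  exact congrArg Subtype.val h1

/-- The elements of `X` that annihilate the homogeneous components of the socle of the ring for
almost all isomorphism classes of simple modules, with respect to a filter. -/
def negligible (l : Filter (SimpleType S)) (X : Type v) [AddCommGroup X] [Module S X] :
    Submodule S X where
  carrier := {x | ∀ᶠ i in l, ∀ (g : i.Carrier →ₗ[S] S) (t : i.Carrier), g t • x = 0}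
  add_mem' {x y} hx hy := by
    filter_upwards [hx, hy] with i hx hy g t
    rw [smul_add, hx, hy, add_zero]
  zero_mem' := by simp
  smul_mem' s x hx := by
    filter_upwards [hx] with i hx g t
    -- Right multiplication by `s` turns `g` into another homomorphism into the ring.
    simpa [mul_smul] using hx (LinearMap.toSpanSingleton S S s ∘ₗ g) t

theorem mem_negligible {l : Filter (SimpleType S)} {x : X} : x ∈ negligible l X ↔
    ∀ᶠ i in l, ∀ (g : i.Carrier →ₗ[S] S) (t : i.Carrier), g t • x = 0 := Iff.rfl

theorem map_mem_negligible {l : Filter (SimpleType S)} (f : X →ₗ[S] Y) {x : X}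
    (hx : x ∈ negligible l X) : f x ∈ negligible l Y := by
  filter_upwards [hx] with i hx g t
  rw [← map_smul, hx, map_zero]

theorem smul_mem_negligible {l : Filter (SimpleType S)} {a : S} (ha : a ∈ negligible l S) (x : X) :
    a • x ∈ negligible l X :=
  map_mem_negligible (LinearMap.toSpanSingleton S X x) ha

instance (l : Filter (SimpleType S)) : Ideal.IsTwoSided (negligible l S) :=
  ⟨fun b ha => smul_mem_negligible ha b⟩

/-- For `g : i.Carrier →ₗ[S] S`, the map `t ↦ g t • x` embeds the simple module in `X` unless it
vanishes. -/
theorem map_mem_negligible_of_notMem_simpleTypes {l : Filter (SimpleType S)}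
    (hl : ∀ᶠ i in l, i ∉ simpleTypes X) (f : X →ₗ[S] Y) (x : X) : f x ∈ negligible l Y := by
  refine map_mem_negligible f ?_
  filter_upwards [hl] with i hi g t
  by_contra h
  exact hi ⟨LinearMap.toSpanSingleton S X x ∘ₗ g, fun h0 => h (by
    simpa using LinearMap.congr_fun h0 t)⟩

/-- The element `x` involves only finitely many generators `q`, so if all were negligible, one type
`i` occurring in `X` would kill all of them. A simple submodule of type `i` meets the span of `x`,
so some nonzero element of it is a combination of these `q` with coefficients in images of
`i.Carrier` in `S`, hence zero. -/
theorem negligible_ne_top [Module.Projective S X] {x : X}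
    (hx : (Submodule.span S {x}).IsEssentialIn) {l : Filter (SimpleType S)} [l.NeBot]
    (hl : ∀ᶠ i in l, i ∈ simpleTypes X) : negligible l X ≠ ⊤ := by
  intro htop
  obtain ⟨s, hs⟩ := Module.projective_def'.1 (inferInstance : Module.Projective S X)
  have hsum : ∀ y : X, (s y).sum (fun q a => a • q) = y := fun y => by
    have := LinearMap.congr_fun hs y
    simpa [Finsupp.linearCombination_apply] using this
  have hG : ∀ᶠ i in l, ∀ q ∈ (s x).support, ∀ (g : i.Carrier →ₗ[S] S) (t : i.Carrier),
      g t • q = 0 :=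
    (Filter.eventually_all_finset _).2 fun q _ =>
      mem_negligible.1 (htop ▸ Submodule.mem_top : q ∈ negligible l X)
  obtain ⟨i, ⟨g, hg⟩, hi⟩ := (hl.and hG).exists
  obtain ⟨y, hy, ⟨t, rfl⟩, hy0⟩ := hx.exists_mem (L := LinearMap.range g)
      (mt LinearMap.range_eq_bot.1 hg)
  obtain ⟨a, ha⟩ := Submodule.mem_span_singleton.1 hy
  refine hy0 ?_
  rw [← hsum (g t), Finsupp.sum]
  refine Finset.sum_eq_zero fun q hq => ?_
  refine hi q ?_ (Finsupp.lapply q ∘ₗ s ∘ₗ g) t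
  rw [← ha, map_smul] at hq
  exact Finsupp.support_smul hq

/-- Projective modules with essential cyclic submodules have pairwise nonisomorphic simple
quotients if filters on the set of isomorphism classes of simple modules separate their socles. -/
theorem exists_injective_simpleType {B : Type w} (Q : B → Type v) [∀ b, AddCommGroup (Q b)]
    [∀ b, Module S (Q b)] [∀ b, Module.Projective S (Q b)] (x : ∀ b, Q b)
    (hx : ∀ b, (Submodule.span S {x b}).IsEssentialIn) (l : B → Filter (SimpleType S))
    [∀ b, (l b).NeBot] (hl : ∀ b, ∀ᶠ i in l b, i ∈ simpleTypes (Q b))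
    (hl' : ∀ b c, b ≠ c → ∀ᶠ i in l b, i ∉ simpleTypes (Q c)) :
    ∃ U : B → SimpleType S, Function.Injective U ∧
      ∀ b, ∃ f : Q b →ₗ[S] (U b).Carrier, Function.Surjective f := by
  have key : ∀ b, ∃ (i : SimpleType S) (f : Q b →ₗ[S] i.Carrier), Function.Surjective f ∧
      ∀ y ∈ negligible (l b) (Q b), f y = 0 := by
    intro b
    obtain ⟨M, hM, hle⟩ := Module.Projective.exists_isCoatom_ge (negligible (l b) (Q b))
      (negligible (l b) S) (fun φ _ h => map_mem_negligible φ h)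
      (fun a ha q => smul_mem_negligible ha q) (negligible_ne_top (hx b) (hl b))
    have : IsSimpleModule S (Q b ⧸ M) := isSimpleModule_iff_isCoatom.2 hM
    obtain ⟨i, ⟨e⟩⟩ := SimpleType.exists_linearEquiv (S := S) (Q b ⧸ M)
    refine ⟨i, e.toLinearMap ∘ₗ M.mkQ, e.surjective.comp M.mkQ_surjective, fun y hy => ?_⟩
    simpa using hle hy
  choose U f hf hf0 using key
  refine ⟨U, fun b c hbc => ?_, fun b => ⟨f b, hf b⟩⟩
  by_contra hne
  obtain ⟨e⟩ : Nonempty ((U c).Carrier ≃ₗ[S] (U b).Carrier) := ⟨hbc ▸ LinearEquiv.refl _ _⟩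
  -- For `b ≠ c` the lift `Q c → Q b` has negligible image, which `f b` kills, although `f b ∘ h` is
  -- surjective.
  obtain ⟨h, hh⟩ := Module.projective_lifting_property (f b) (e.toLinearMap ∘ₗ f c) (hf b)
  have : Nontrivial (U c).Carrier := IsSimpleModule.nontrivial S _
  obtain ⟨z, hz⟩ := exists_ne (0 : (U c).Carrier)
  obtain ⟨q, rfl⟩ := hf c z
  have h1 : f b (h q) = e (f c q) := LinearMap.congr_fun hh q
  rw [hf0 b _ (map_mem_negligible_of_notMem_simpleTypes (hl' b c hne) h q)] at h1
  exact hz (by simpa using h1.symm)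

/-- A left ideal maximal among those without simple submodules of the types in `A`. -/
theorem exists_maximal_avoiding (A : Set (SimpleType S)) : ∃ I : Submodule S S,
    (∀ i ∈ A, ∀ g : i.Carrier →ₗ[S] S, LinearMap.range g ≤ I → g = 0) ∧
      ∀ L, I < L → ∃ i ∈ A, ∃ g : i.Carrier →ₗ[S] S, LinearMap.range g ≤ L ∧ g ≠ 0 := by
  obtain ⟨I, -, hI⟩ := zorn_le_nonempty₀
    {I : Submodule S S | ∀ i ∈ A, ∀ g : i.Carrier →ₗ[S] S, LinearMap.range g ≤ I → g = 0}
    (fun c hc hch y hy => by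
      refine ⟨sSup c, fun i hi g hg => ?_, fun z hz => le_sSup hz⟩
      by_contra hg0
      obtain ⟨t, ht⟩ := DFunLike.ne_iff.1 hg0
      have ht0 : t ≠ 0 := by rintro rfl; simp at ht
      obtain ⟨K, hK, htK⟩ := (Submodule.mem_sSup_of_directed ⟨y, hy⟩ hch.directedOn).1
        (hg ⟨t, rfl⟩)
      refine hg0 (hc hK i hi g ?_)
      rwa [LinearMap.range_eq_span_of_ne_zero g ht0, Submodule.span_singleton_le_iff_mem]) ⊥ (fun i _ g hg => LinearMap.range_eq_bot.1 (le_bot_iff.1 hg))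
  refine ⟨I, hI.1, fun L hL => ?_⟩
  by_contra! hc
  exact hL.not_ge (hI.2 hc hL.le)

/-- Types in `A` survive modulo `I` because `I` avoids them and `S` contains them. Conversely, a
simple submodule of `X` pulls back to a left ideal above `I`, which by maximality contains a simple
of type in `A`; this maps isomorphically onto it. -/
theorem simpleTypes_eq_of_avoiding (hS : ∀ i, i ∈ simpleTypes (S := S) S)
    {A : Set (SimpleType S)} {I : Submodule S S}
    (hI : ∀ i ∈ A, ∀ g : i.Carrier →ₗ[S] S, LinearMap.range g ≤ I → g = 0)
    (hI' : ∀ L, I < L → ∃ i ∈ A, ∃ g : i.Carrier →ₗ[S] S, LinearMap.range g ≤ L ∧ g ≠ 0)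
    (f : (S ⧸ I) →ₗ[S] X) (hf : f.IsEssentialEmbedding) : simpleTypes X = A := by
  have hne : ∀ i ∈ A, ∀ g : i.Carrier →ₗ[S] S, g ≠ 0 → f ∘ₗ I.mkQ ∘ₗ g ≠ 0 := by
    intro i hi g hg h0
    refine hg (hI i hi g ?_)
    rintro _ ⟨t, rfl⟩
    rw [← Submodule.Quotient.mk_eq_zero I]
    exact hf.1 (by simpa using LinearMap.congr_fun h0 t)
  ext i
  constructor
  · rintro ⟨g, hg⟩
    obtain ⟨y, ⟨z, rfl⟩, hy, hy0⟩ := hf.2.exists_mem (L := LinearMap.range g)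
      (mt LinearMap.range_eq_bot.1 hg)
    obtain ⟨s, rfl⟩ := I.mkQ_surjective z
    have hlt : I < (LinearMap.range g).comap (f ∘ₗ I.mkQ) := by
      refine lt_of_le_of_ne (fun a ha => ?_) fun heq => hy0 ?_
      · have : f (I.mkQ a) = 0 := by simp [(Submodule.Quotient.mk_eq_zero I).2 ha]
        simp only [Submodule.mem_comap, LinearMap.comp_apply, this, Submodule.zero_mem]
      · have hs : s ∈ I := by rw [heq]; exact hy
        simp [(Submodule.Quotient.mk_eq_zero I).2 hs]
    obtain ⟨j, hj, h, hle, hh⟩ := hI' _ hlt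
    have := SimpleType.eq_of_range_le g (f ∘ₗ I.mkQ ∘ₗ h) (hne j hj h hh) (by
      rintro _ ⟨t, rfl⟩
      exact hle ⟨t, rfl⟩)
    exact this ▸ hj
  · intro hi
    obtain ⟨g, hg⟩ := hS i
    exact ⟨_, hne i hi g hg⟩

end SimpleType

/-! ### Fitting's lemma. -/

section Fitting

variable {S : Type u} [Ring S]

/-- An endomorphism of an indecomposable module of finite length is nilpotent or bijective, and `π ∘
f ^ n = π ≠ 0` excludes nilpotence. -/
theorem Module.IsIndecomposable.bijective_of_comp_eq {M : Type v} {T : Type w} [AddCommGroup M]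
    [Module S M] [AddCommGroup T] [Module S T] [IsNoetherian S M] [IsArtinian S M]
    (hM : Module.IsIndecomposable S M) (f : M →ₗ[S] M) (π : M →ₗ[S] T) (hπ : π ≠ 0)
    (h : π ∘ₗ f = π) : Function.Bijective f := by
  obtain ⟨n, hn, hn1⟩ := ((LinearMap.eventually_isCompl_ker_pow_range_pow f).and
    (Filter.eventually_ge_atTop 1)).exists
  have hpow : ∀ (k : ℕ) (x : M), π ((f ^ k) x) = π x := by
    intro k
    induction k with
    | zero => simp
    | succ k ih =>
      intro x
      rw [pow_succ, Module.End.mul_apply, ih]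
      exact LinearMap.congr_fun h x
  refine IsArtinian.bijective_of_injective_endomorphism f ?_
  rcases hM.2 _ _ hn with h0 | h0
  · obtain ⟨m, rfl⟩ : ∃ m, n = m + 1 := ⟨n - 1, by omega⟩
    rw [← LinearMap.ker_eq_bot, eq_bot_iff, ← h0]
    intro x hx
    rw [LinearMap.mem_ker] at hx ⊢
    rw [pow_succ, Module.End.mul_apply, hx, map_zero]
  · refine absurd (LinearMap.ext fun x => ?_) hπ
    rw [← hpow n x, LinearMap.range_eq_bot.1 h0]
    simp

end Fitting

/-! ### Finiteness of the set of simple types. -/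

section CEP

/-- Every cyclic module essentially embeds in a projective module. -/
def CyclicsEssentiallyEmbed (S : Type u) [Ring S] : Prop :=
  ∀ (C : Type u) [AddCommGroup C] [Module S C], Module.IsCyclicModule S C →
    ∃ (P : Type u) (_ : AddCommGroup P) (_ : Module S P),
      Module.Projective S P ∧ Module.EssentiallyEmbedsIn S C P

variable {S : Type u} [Ring S]

theorem Module.IsCyclicModule.of_surjective {N : Type v} [AddCommGroup N] [Module S N]
    (f : S →ₗ[S] N) (hf : Function.Surjective f) : Module.IsCyclicModule S N := by
  refine ⟨f 1, eq_top_iff.2 fun x _ => ?_⟩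
  obtain ⟨s, rfl⟩ := hf x
  exact Submodule.mem_span_singleton.2 ⟨s, by rw [← map_smul, smul_eq_mul, mul_one]⟩

theorem Module.isCyclicModule_quotient (I : Submodule S S) : Module.IsCyclicModule S (S ⧸ I) :=
  .of_surjective I.mkQ I.mkQ_surjective

theorem LinearMap.range_eq_span_of_span_eq_top {C : Type v} {Q : Type w} [AddCommGroup C]
    [Module S C] [AddCommGroup Q] [Module S Q] (f : C →ₗ[S] Q) {c : C}
    (hc : Submodule.span S {c} = ⊤) : LinearMap.range f = Submodule.span S {f c} := by
  rw [LinearMap.range_eq_map, ← hc, Submodule.map_span, Set.image_singleton]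

theorem Module.Projective.exists_ne_zero {Q : Type v} [AddCommGroup Q] [Module S Q]
    [Module.Projective S Q] {x : Q} (hx : x ≠ 0) : ∃ φ : Q →ₗ[S] S, φ x ≠ 0 := by
  obtain ⟨s, hs⟩ := Module.projective_def'.1 (inferInstance : Module.Projective S Q)
  by_contra! hc
  refine hx ?_
  have h0 : s x = 0 := Finsupp.ext fun q => hc (Finsupp.lapply q ∘ₗ s)
  simpa [h0] using (LinearMap.congr_fun hs x).symm

theorem CyclicsEssentiallyEmbed.mem_simpleTypes (h : CyclicsEssentiallyEmbed S)
    (i : SimpleType S) : i ∈ simpleTypes (S := S) S := by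
  obtain ⟨Q, _, _, hQ, f, hf⟩ := h i.Carrier (Module.isCyclicModule_quotient _)
  obtain ⟨x, hx⟩ := @exists_ne _ (IsSimpleModule.nontrivial S i.Carrier) 0
  obtain ⟨φ, hφ⟩ := Module.Projective.exists_ne_zero (S := S)
    (fun h0 => hx (hf.1 (h0.trans (map_zero f).symm)))
  exact ⟨φ ∘ₗ f, fun h0 => hφ (LinearMap.congr_fun h0 x)⟩

/-- On an infinite set there is an independent family of subsets, indexed by all subsets. -/
theorem exists_independent_family (Ω : Type u) [Infinite Ω] : ∃ A : Set Ω → Set Ω,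
    ∀ (X : Set Ω) (F : Finset (Set Ω)), X ∉ F → ∃ i ∈ A X, ∀ Y ∈ F, i ∉ A Y := by
  classical
  have hcard : Cardinal.mk Ω = Cardinal.mk (Finset Ω × Finset (Finset Ω)) := by
    simp
  obtain ⟨e⟩ := Cardinal.eq.1 hcard
  -- Hausdorff's construction: an index codes a finite set together with a finite family of its
  -- possible traces. The witness below uses points separating `X` from each `Y ∈ F`, and only the
  -- trace of `X`.
  refine ⟨fun X => {i | (e i).1.filter (· ∈ X) ∈ (e i).2}, fun X F hXF => ?_⟩
  have hsep : ∀ Y ∈ F, ∃ a, ¬(a ∈ X ↔ a ∈ Y) := fun Y hY => by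
    by_contra! hc
    exact hXF (Set.ext hc ▸ hY)
  choose! a ha using hsep
  refine ⟨e.symm (F.image a, {(F.image a).filter (· ∈ X)}), by simp, fun Y hY hmem => ha Y hY ?_⟩
  simp only [Set.mem_ofPred_eq, Equiv.apply_symm_apply, Finset.mem_singleton] at hmem
  have := Finset.ext_iff.1 hmem (a Y)
  simp only [Finset.mem_filter, Finset.mem_image_of_mem a hY, true_and] at this
  exact this.symm

/-- On an infinite set of types, the independent sets `A X` occur as socle types of projectives with
essential cyclic submodules. Their distinct simple quotients would inject the power set into the set
of types. -/
theorem CyclicsEssentiallyEmbed.finite_simpleType (h : CyclicsEssentiallyEmbed S) :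
    Finite (SimpleType S) := by
  classical
  by_contra hinf
  rw [not_finite_iff_infinite] at hinf
  obtain ⟨A, hA⟩ := exists_independent_family (SimpleType S)
  have key : ∀ X : Set (SimpleType S), ∃ (Q : Type u) (_ : AddCommGroup Q) (_ : Module S Q),
      Module.Projective S Q ∧ ∃ x : Q, (Submodule.span S {x}).IsEssentialIn ∧
        simpleTypes (S := S) Q = A X := by
    intro X
    obtain ⟨I, hI, hI'⟩ := exists_maximal_avoiding (A X)
    have hc := Module.isCyclicModule_quotient I
    obtain ⟨Q, _, _, hQ, f, hf⟩ := h (S ⧸ I) hc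
    obtain ⟨c, hc⟩ := hc
    exact ⟨Q, inferInstance, inferInstance, hQ, f c,
      LinearMap.range_eq_span_of_span_eq_top f hc ▸ hf.2,
      simpleTypes_eq_of_avoiding h.mem_simpleTypes hI hI' f hf⟩
  choose Q iA iM hQ x hx hA' using key
  -- Independence makes this filter proper; it contains `A X` and the complement of every `A Y` with
  -- `Y ≠ X`.
  let l : Set (SimpleType S) → Filter (SimpleType S) := fun X =>
    ⨅ F : {F : Finset (Set (SimpleType S)) // X ∉ F},
      Filter.principal {i | i ∈ A X ∧ ∀ Y ∈ F.1, i ∉ A Y}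
  have hl : ∀ X, (l X).NeBot := by
    intro X
    have : Nonempty {F : Finset (Set (SimpleType S)) // X ∉ F} := ⟨∅, by simp⟩
    refine Filter.iInf_neBot_of_directed' (fun F G => ⟨⟨F.1 ∪ G.1, by simp [F.2, G.2]⟩, ?_, ?_⟩)
      fun F => Filter.principal_neBot_iff.2 (hA X F.1 F.2)
    · exact Filter.principal_mono.2 fun i hi => ⟨hi.1, fun Y hY => hi.2 Y (by simp [hY])⟩
    · exact Filter.principal_mono.2 fun i hi => ⟨hi.1, fun Y hY => hi.2 Y (by simp [hY])⟩
  obtain ⟨U, hU, -⟩ := exists_injective_simpleType Q x hx l (fun X => by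
    rw [hA']
    exact Filter.mem_iInf_of_mem ⟨∅, by simp⟩ fun i hi => hi.1) (fun X Y hXY => by
    rw [hA']
    exact Filter.mem_iInf_of_mem ⟨{Y}, by simpa using hXY⟩ fun i hi => hi.2 Y (by simp))
  exact Function.cantor_injective U hU

/-- With the principal filters `pure i`, the assignment of a simple quotient to `P i` is injective
on a finite set, hence surjective. -/
theorem CyclicsEssentiallyEmbed.exists_uniform_projectives (h : CyclicsEssentiallyEmbed S) :
    ∃ (P : SimpleType S → Type u) (_ : ∀ i, AddCommGroup (P i)) (_ : ∀ i, Module S (P i)),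
      (∀ i, Module.Projective S (P i)) ∧
      (∀ i, ∃ f : i.Carrier →ₗ[S] P i, f.IsEssentialEmbedding) ∧
      ∀ j : SimpleType S, ∃ (i : SimpleType S) (f : P i →ₗ[S] j.Carrier),
        Function.Surjective f := by
  have key : ∀ i : SimpleType S, ∃ (Q : Type u) (_ : AddCommGroup Q) (_ : Module S Q),
      Module.Projective S Q ∧ (∃ f : i.Carrier →ₗ[S] Q, f.IsEssentialEmbedding) ∧
        ∃ x : Q, (Submodule.span S {x}).IsEssentialIn := by
    intro i
    have hc := Module.isCyclicModule_quotient (Quotient.out i).1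
    obtain ⟨Q, _, _, hQ, f, hf⟩ := h i.Carrier hc
    obtain ⟨c, hc⟩ := hc
    exact ⟨Q, inferInstance, inferInstance, hQ, ⟨f, hf⟩, f c,
      LinearMap.range_eq_span_of_span_eq_top f hc ▸ hf.2⟩
  choose P iA iM hP hf x hx using key
  refine ⟨P, iA, iM, hP, hf, ?_⟩
  have htypes : ∀ i, simpleTypes (S := S) (P i) = {i} := fun i => by
    obtain ⟨f, hf⟩ := hf i
    rw [← simpleTypes_eq_of_isEssentialEmbedding f hf, SimpleType.simpleTypes_carrier]
  obtain ⟨U, hU, hU'⟩ := exists_injective_simpleType P x hx (fun i => pure i)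
    (fun i => by simp [htypes]) (fun i j hij => by simpa [htypes] using hij)
  have := h.finite_simpleType
  intro j
  obtain ⟨i, rfl⟩ := Finite.surjective_of_injective hU j
  exact ⟨i, hU' i⟩

end CEP

/-! ### The artinian property and the indecomposable projectives. -/

section CEP

variable {S : Type u} [Ring S]

/-- A module in a finite product of modules with essential simple submodules has the descending
chain condition for chains with zero intersection. -/
theorem exists_eq_bot_of_iInf_eq_bot {C : Type v} [AddCommGroup C] [Module S C] {κ : Type*}
    [Fintype κ] {T : κ → Type*} {P : κ → Type*} [∀ k, AddCommGroup (T k)] [∀ k, Module S (T k)]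
    [∀ k, AddCommGroup (P k)] [∀ k, Module S (P k)] [∀ k, IsArtinian S (T k)]
    (f : ∀ k, T k →ₗ[S] P k) (hf : ∀ k, (f k).IsEssentialEmbedding) (h : C →ₗ[S] ∀ k, P k)
    (hh : Function.Injective h) (N : ℕ → Submodule S C) (hN : Antitone N) (hN0 : ⨅ n, N n = ⊥) :
    ∃ n, N n = ⊥ := by
  let e : (∀ k, T k) →ₗ[S] ∀ k, P k := LinearMap.pi fun k => f k ∘ₗ LinearMap.proj k
  have he : (LinearMap.range e).IsEssentialIn := by
    refine (Submodule.isEssentialIn_pi _ fun k => (hf k).2).mono fun y hy => ?_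
    choose t ht using fun k => hy k (Set.mem_univ k)
    exact ⟨t, funext ht⟩
  let W : ℕ →o (Submodule S (∀ k, T k))ᵒᵈ :=
    ⟨fun n => OrderDual.toDual (((N n).map h).comap e), fun m n hmn =>
      Submodule.comap_mono (Submodule.map_mono (hN hmn))⟩
  -- On the essential submodule `∏ T k` the chain becomes stationary, and its stable value lies in
  -- the zero intersection.
  obtain ⟨n, hn⟩ := IsArtinian.monotone_stabilizes W
  have hW : ∀ m, n ≤ m → ((N n).map h).comap e = ((N m).map h).comap e := fun m hm => hn m hm
  refine ⟨n, Submodule.map_injective_of_injective hh ?_⟩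
  rw [Submodule.map_bot]
  refine he _ (eq_bot_iff.2 ?_)
  rintro _ ⟨⟨t, rfl⟩, ⟨c, hc, hct⟩⟩
  have hcm : c ∈ ⨅ m, N m := by
    rw [Submodule.mem_iInf]
    have key : ∀ m, n ≤ m → c ∈ N m := fun m hm => by
      have ht : t ∈ ((N n).map h).comap e := ⟨c, hc, hct⟩
      rw [hW m hm] at ht
      obtain ⟨d, hd, hdt⟩ := ht
      rwa [hh (hct.trans hdt.symm)]
    intro m
    exact hN (le_max_left m n) (key _ (le_max_right m n))
  rw [hN0, Submodule.mem_bot] at hcm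
  rw [← hct, hcm, map_zero]
  exact Submodule.zero_mem _

/-- If every simple module is a quotient of some `P i`, then the ring embeds in a finite product
of modules `P i`. -/
theorem exists_injective_pi_of_surjective {ι : Type w} (P : ι → Type v) [∀ i, AddCommGroup (P i)]
    [∀ i, Module S (P i)] [∀ i, Module.Projective S (P i)]
    (hP : ∀ j : SimpleType S, ∃ (i : ι) (f : P i →ₗ[S] j.Carrier), Function.Surjective f) :
    ∃ (n : ℕ) (k : Fin n → ι) (f : S →ₗ[S] ∀ m, P (k m)), Function.Injective f := by
  -- The span of `X` is the trace of the `P i`. It lies in no maximal left ideal `m`, since a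
  -- surjection from some `P i` onto `S ⧸ m` lifts to `S`.
  let X : Set S := {s | ∃ (i : ι) (φ : P i →ₗ[S] S) (p : P i), φ p = s}
  have htop : Submodule.span S X = ⊤ := by
    by_contra hne
    obtain ⟨m, hm, hle⟩ := Ideal.exists_le_maximal _ hne
    have : IsSimpleModule S (S ⧸ m) := isSimpleModule_iff_isCoatom.2 hm.out
    obtain ⟨j, ⟨e⟩⟩ := SimpleType.exists_linearEquiv (S := S) (S ⧸ m)
    obtain ⟨i, f, hf⟩ := hP j
    obtain ⟨φ, hφ⟩ := Module.projective_lifting_property m.mkQ (e.symm.toLinearMap ∘ₗ f)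
      m.mkQ_surjective
    obtain ⟨p, hp⟩ := hf (e (m.mkQ 1))
    have h1 : m.mkQ (φ p) = m.mkQ 1 := by
      have := LinearMap.congr_fun hφ p
      simpa [hp] using this
    have h2 : φ p ∈ m := hle (Submodule.subset_span ⟨i, φ, p, rfl⟩)
    have h3 : m.mkQ (1 : S) = 0 := by
      rw [← h1]
      simpa using (Submodule.Quotient.mk_eq_zero m).2 h2
    exact hm.ne_top ((Ideal.eq_top_iff_one m).2 (by
      simpa [Submodule.Quotient.mk_eq_zero] using h3))
  obtain ⟨n, a, g, hg⟩ := (Submodule.mem_span_set' (s := X)).1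
    (htop ▸ Submodule.mem_top : (1 : S) ∈ Submodule.span S X)
  choose k φ p hp using fun m => (g m).2
  refine ⟨n, k, LinearMap.pi fun m => LinearMap.toSpanSingleton S _ (a m • p m), ?_⟩
  rw [← LinearMap.ker_eq_bot, eq_bot_iff]
  intro s hs
  have hs' : ∀ m, s • a m • p m = 0 := fun m => congrFun (LinearMap.mem_ker.1 hs) m
  have : s • (1 : S) = 0 := by
    rw [← hg, Finset.smul_sum]
    refine Finset.sum_eq_zero fun m _ => ?_
    rw [← hp m, ← map_smul, ← map_smul, hs', map_zero]
  simpa using this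

/-- Dividing by the intersection `I` of a descending chain reduces to zero intersection in the
cyclic module `S ⧸ I`. This embeds in a free module, where the finitely many coordinates of the
generator suffice, and so in a finite product of the `P i`. -/
theorem CyclicsEssentiallyEmbed.isArtinian (h : CyclicsEssentiallyEmbed S) : IsArtinian S S := by
  obtain ⟨P, _, _, hP, hf, hsurj⟩ := h.exists_uniform_projectives
  choose f hf using hf
  obtain ⟨n, k, e, he⟩ := exists_injective_pi_of_surjective P hsurj
  rw [← monotone_stabilizes_iff_artinian]
  intro N
  let N' : ℕ → Submodule S S := fun m => OrderDual.ofDual (N m)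
  have hN' : Antitone N' := fun a b hab => N.monotone hab
  let I : Submodule S S := ⨅ m, N' m
  have hIN : ∀ m, I ≤ N' m := iInf_le N'
  obtain ⟨Q, _, _, hQ, g, hg⟩ := h (S ⧸ I) (Module.isCyclicModule_quotient I)
  obtain ⟨s, hs⟩ := Module.projective_def'.1 hQ
  have hs : Function.Injective s := fun x y hxy => by
    have h1 := LinearMap.congr_fun hs x
    have h2 := LinearMap.congr_fun hs y
    simp only [LinearMap.comp_apply, LinearMap.id_apply] at h1 h2
    rw [← h1, ← h2, hxy]
  let c : Q →₀ S := s (g (I.mkQ 1))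
  let H : (S ⧸ I) →ₗ[S] ∀ p : c.support × Fin n, P (k p.2) :=
    LinearMap.pi fun p => LinearMap.proj p.2 ∘ₗ e ∘ₗ Finsupp.lapply (p.1 : Q) ∘ₗ s ∘ₗ g
  have hH : Function.Injective H := by
    rw [← LinearMap.ker_eq_bot, eq_bot_iff]
    intro x hx
    have hx' : ∀ q : c.support, s (g x) q = 0 := fun q => he (by
      ext m
      rw [map_zero]
      exact congrFun (LinearMap.mem_ker.1 hx) (q, m))
    have hx0 : s (g x) = 0 := by
      ext q
      obtain ⟨a, rfl⟩ := I.mkQ_surjective x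
      by_cases hq : q ∈ c.support
      · exact hx' ⟨q, hq⟩
      · have : s (g (I.mkQ a)) = a • c := by
          rw [← map_smul, ← map_smul, ← map_smul, smul_eq_mul, mul_one]
        rw [this, Finsupp.smul_apply, Finsupp.notMem_support_iff.1 hq, smul_zero]
        rfl
    exact (map_eq_zero_iff (s ∘ₗ g) (hs.comp hg.1)).1 hx0
  obtain ⟨m, hm⟩ := exists_eq_bot_of_iInf_eq_bot
    (f := fun p : c.support × Fin n => f (k p.2)) (fun p => hf (k p.2)) H hH
    (fun m => (N' m).map I.mkQ) (fun a b hab => Submodule.map_mono (hN' hab)) (by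
      rw [eq_bot_iff]
      intro x hx
      obtain ⟨a, rfl⟩ := I.mkQ_surjective x
      rw [Submodule.mem_iInf] at hx
      have ha : a ∈ I := (Submodule.mem_iInf _).2 fun m => by
        obtain ⟨b, hb, hba⟩ := hx m
        have : b - a ∈ I := (Submodule.Quotient.eq I).1 hba
        have := sub_mem hb (hIN m this)
        simpa using this
      simpa using (Submodule.Quotient.mk_eq_zero I).2 ha)
  have hmI : ∀ r, m ≤ r → N' r = I := fun r hr => le_antisymm (fun x hx => by
    have : I.mkQ x ∈ (N' m).map I.mkQ := ⟨x, hN' hr hx, rfl⟩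
    rw [hm, Submodule.mem_bot] at this
    exact (Submodule.Quotient.mk_eq_zero I).1 this) (hIN r)
  exact ⟨m, fun r hr => ((hmI m le_rfl).trans (hmI r hr).symm)⟩

/-- If every simple module is a quotient of one of the uniform projective modules `P i`, then the
`P i` are, up to isomorphism, all the indecomposable projective modules. -/
theorem Module.IsIndecomposable.exists_linearEquiv {ι : Type w} (P : ι → Type v)
    [∀ i, AddCommGroup (P i)] [∀ i, Module S (P i)] [∀ i, Module.Projective S (P i)]
    [∀ i, IsArtinian S (P i)] [∀ i, IsNoetherian S (P i)]
    (hU : ∀ i, Module.IsIndecomposable S (P i))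
    (hP : ∀ j : SimpleType S, ∃ (i : ι) (f : P i →ₗ[S] j.Carrier), Function.Surjective f)
    {Q : Type u} [AddCommGroup Q] [Module S Q] [Module.Projective S Q]
    (hQ : Module.IsIndecomposable S Q) : ∃ i, Nonempty (Q ≃ₗ[S] P i) := by
  have := hQ.1
  obtain ⟨M, hM⟩ := Module.Projective.exists_isCoatom (S := S) (Q := Q)
  have : IsSimpleModule S (Q ⧸ M) := isSimpleModule_iff_isCoatom.2 hM
  obtain ⟨j, ⟨e⟩⟩ := SimpleType.exists_linearEquiv (S := S) (Q ⧸ M)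
  obtain ⟨i, ρ, hρ⟩ := hP j
  let π : Q →ₗ[S] j.Carrier := e.toLinearMap ∘ₗ M.mkQ
  have hπ : Function.Surjective π := e.surjective.comp M.mkQ_surjective
  obtain ⟨f, hf⟩ := Module.projective_lifting_property ρ π hρ
  obtain ⟨g, hg⟩ := Module.projective_lifting_property π ρ hπ
  have hρ0 : ρ ≠ 0 := by
    rintro rfl
    obtain ⟨x, hx⟩ := @exists_ne _ (IsSimpleModule.nontrivial S j.Carrier) 0
    obtain ⟨y, rfl⟩ := hρ x
    exact hx rfl
  have hb := (hU i).bijective_of_comp_eq (f ∘ₗ g) ρ hρ0 (by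
    rw [← LinearMap.comp_assoc, hf, hg])
  have hcompl : IsCompl (LinearMap.range g) (LinearMap.ker f) := by
    constructor
    -- Since `f ∘ g` is bijective, `g` splits `f` up to an automorphism; indecomposability of `Q`
    -- then forces `ker f = ⊥`.
    · rw [Submodule.disjoint_def]
      rintro _ ⟨x, rfl⟩ hx
      have : (f ∘ₗ g) x = (f ∘ₗ g) 0 := by simpa using hx
      rw [hb.1 this, map_zero]
    · rw [codisjoint_iff, eq_top_iff]
      intro q _
      obtain ⟨x, hx⟩ := hb.2 (f q)
      refine Submodule.mem_sup.2 ⟨g x, ⟨x, rfl⟩, q - g x, ?_, by abel⟩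
      rw [LinearMap.mem_ker, map_sub, ← hx]
      exact sub_self _
  have := (hU i).1
  rcases hQ.2 _ _ hcompl with h0 | h0
  · obtain ⟨x, hx⟩ := exists_ne (0 : P i)
    refine absurd (hb.1 (a₁ := x) (a₂ := 0) ?_) hx
    have : g = 0 := LinearMap.range_eq_bot.1 h0
    simp [this]
  · exact ⟨i, ⟨LinearEquiv.ofBijective f ⟨LinearMap.ker_eq_bot.1 h0, fun y => by
      obtain ⟨x, hx⟩ := hb.2 y
      exact ⟨g x, hx⟩⟩⟩⟩

theorem Module.IsUniform.of_linearEquiv {M : Type v} {N : Type w} [AddCommGroup M]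
    [AddCommGroup N] [Module S M] [Module S N] (h : Module.IsUniform S N) (e : M ≃ₗ[S] N) :
    Module.IsUniform S M :=
  have := h.1
  have := e.toEquiv.nontrivial
  h.of_injective e.toLinearMap e.injective

theorem simpleTypes_eq_of_linearEquiv {M : Type v} {N : Type w} [AddCommGroup M]
    [AddCommGroup N] [Module S M] [Module S N] (e : M ≃ₗ[S] N) :
    simpleTypes (S := S) M = simpleTypes N :=
  (simpleTypes_mono e.toLinearMap e.injective).antisymm
    (simpleTypes_mono e.symm.toLinearMap e.symm.injective)

theorem LinearMap.IsEssentialEmbedding.nontrivial {M : Type v} {N : Type w} [AddCommGroup M]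
    [AddCommGroup N] [Module S M] [Module S N] [Nontrivial N] {f : M →ₗ[S] N}
    (hf : f.IsEssentialEmbedding) : Nontrivial M := by
  obtain ⟨_, ⟨x, rfl⟩, -, hx⟩ := hf.2.exists_mem (top_ne_bot (α := Submodule S N))
  exact ⟨x, 0, fun h => hx (by rw [h, map_zero])⟩

/-- The `P i` embed in `S`, so they have finite length and exhaust the indecomposable projectives. A
quotient of `N` essential in `E(P')` is uniform and cyclic, so it is essential in some `P j`;
comparing socles gives `P j ≅ P'`. -/
theorem CyclicsEssentiallyEmbed.isUniform_and_isStronglyTight (h : CyclicsEssentiallyEmbed S)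
    {N : Type u} [AddCommGroup N] [Module S N] (eN : S ≃ₗ[S] N) {P' : Type u} [AddCommGroup P']
    [Module S P'] (hproj : Module.Projective S P') (hind : Module.IsIndecomposable S P') :
    Module.IsUniform S P' ∧ Module.IsStronglyTight S N P' := by
  have := h.isArtinian
  have : IsArtinianRing S := this
  obtain ⟨P, _, _, hP, hf, hsurj⟩ := h.exists_uniform_projectives
  choose f hf using hf
  have hU : ∀ i, Module.IsUniform S (P i) := fun i =>
    Module.IsUniform.of_isSimpleModule.of_essential (f i) (hf i)
  have hsub : ∀ i, ∃ φ : P i →ₗ[S] S, Function.Injective φ := by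
    intro i
    obtain ⟨x, hx⟩ := @exists_ne _ (IsSimpleModule.nontrivial S i.Carrier) 0
    obtain ⟨φ, hφ⟩ := Module.Projective.exists_ne_zero (S := S)
      (fun h0 => hx ((hf i).1 (h0.trans (map_zero _).symm)))
    have hinj : Function.Injective (φ ∘ₗ f i) := LinearMap.injective_of_ne_zero fun h0 =>
      hφ (LinearMap.congr_fun h0 x)
    refine ⟨φ, LinearMap.injective_of_isEssentialIn (hf i).2 φ ?_⟩
    rintro _ ⟨t, rfl⟩ ht
    rw [hinj (a₁ := t) (a₂ := 0) (by simpa using ht), map_zero]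
  have hart : ∀ i, IsArtinian S (P i) := fun i => (hsub i).elim fun φ hφ =>
    isArtinian_of_injective φ hφ
  have hnoeth : ∀ i, IsNoetherian S (P i) := fun i => (hsub i).elim fun φ hφ =>
    isNoetherian_of_injective φ hφ
  have htypes : ∀ i, simpleTypes (S := S) (P i) = {i} := fun i => by
    rw [← simpleTypes_eq_of_isEssentialEmbedding (f i) (hf i), SimpleType.simpleTypes_carrier]
  obtain ⟨i, ⟨e⟩⟩ := hind.exists_linearEquiv P (fun i => (hU i).isIndecomposable) hsurj
  have hU' : Module.IsUniform S P' := (hU i).of_linearEquiv e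
  refine ⟨hU', ?_⟩
  intro E _ _ κ hκ K ⟨g, hg⟩
  have hUE : Module.IsUniform S E := hU'.of_essential κ hκ.2
  have := hUE.1
  have := hg.nontrivial
  obtain ⟨Q, _, _, hQ, q, hq⟩ := h (N ⧸ K) (.of_surjective (K.mkQ ∘ₗ eN.toLinearMap)
    (K.mkQ_surjective.comp eN.surjective))
  have hUQ : Module.IsUniform S Q := (hUE.of_injective g hg.1).of_essential q hq
  obtain ⟨j, ⟨e'⟩⟩ := hUQ.isIndecomposable.exists_linearEquiv P
    (fun i => (hU i).isIndecomposable) hsurj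
  have hij : ({i} : Set (SimpleType S)) = {j} := by
    rw [← htypes, ← htypes, ← simpleTypes_eq_of_linearEquiv e, ← simpleTypes_eq_of_linearEquiv e',
      simpleTypes_eq_of_isEssentialEmbedding κ hκ.2, ← simpleTypes_eq_of_isEssentialEmbedding g hg,
      simpleTypes_eq_of_isEssentialEmbedding q hq]
  obtain rfl : i = j := Set.singleton_injective hij
  exact ⟨e.symm.toLinearMap ∘ₗ e'.toLinearMap ∘ₗ q,
    e.symm.injective.comp (e'.injective.comp hq.1)⟩

end CEP

/-! ### The converse: building the embeddings over an artinian ring. -/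

section Converse

variable {S : Type u} [Ring S]

theorem IsSimpleModule.nonempty_linearEquiv_of_ker_le {A : Type v} {T T' : Type w} [AddCommGroup A]
    [Module S A] [AddCommGroup T] [Module S T] [AddCommGroup T'] [Module S T'] [IsSimpleModule S T]
    [IsSimpleModule S T'] {π : A →ₗ[S] T} {π' : A →ₗ[S] T'} (hπ : Function.Surjective π)
    (hπ' : Function.Surjective π') (hle : LinearMap.ker π ≤ LinearMap.ker π') :
    Nonempty (T ≃ₗ[S] T') := by
  have heq : LinearMap.ker π = LinearMap.ker π' :=
    ((LinearMap.isCoatom_ker_of_surjective hπ).le_iff.1 hle).resolve_left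
      (LinearMap.isCoatom_ker_of_surjective hπ').1 |>.symm
  exact ⟨(π.quotKerEquivOfSurjective hπ).symm.trans
    ((Submodule.quotEquivOfEq _ _ heq).trans (π'.quotKerEquivOfSurjective hπ'))⟩

/-- An indecomposable projective module of finite length has only one simple quotient. -/
theorem Module.IsIndecomposable.nonempty_linearEquiv_of_surjective {A : Type v} {T T' : Type w}
    [AddCommGroup A] [Module S A] [AddCommGroup T] [Module S T] [AddCommGroup T'] [Module S T']
    [IsSimpleModule S T] [IsSimpleModule S T'] [IsNoetherian S A] [IsArtinian S A]
    [Module.Projective S A] (hA : Module.IsIndecomposable S A) {π : A →ₗ[S] T} {π' : A →ₗ[S] T'}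
    (hπ : Function.Surjective π) (hπ' : Function.Surjective π') : Nonempty (T ≃ₗ[S] T') := by
  by_cases hle : LinearMap.ker π' ≤ LinearMap.ker π
  · exact (IsSimpleModule.nonempty_linearEquiv_of_ker_le hπ' hπ hle).map LinearEquiv.symm
  exfalso
  obtain ⟨x, hx, hxπ⟩ := SetLike.not_le_iff_exists.1 hle
  have hne : π ∘ₗ (LinearMap.ker π').subtype ≠ 0 := fun h0 =>
    hxπ (LinearMap.congr_fun h0 ⟨x, hx⟩)
  -- Lifting `π` through its restriction to `ker π'` gives an endomorphism over `π` with image in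
  -- `ker π'`; Fitting's lemma makes it bijective, so `π' = 0`.
  obtain ⟨h, hh⟩ := Module.projective_lifting_property _ π (LinearMap.surjective_of_ne_zero hne)
  have hb := hA.bijective_of_comp_eq ((LinearMap.ker π').subtype ∘ₗ h) π
    (fun h0 => hxπ (by simp [h0])) hh
  obtain ⟨t, ht⟩ := @exists_ne _ (IsSimpleModule.nontrivial S T') 0
  obtain ⟨y, rfl⟩ := hπ' t
  obtain ⟨z, rfl⟩ := hb.2 y
  exact ht (h z).2

/-- Intersect `K` with the members of `G` one at a time. At the step where the result falls into
`M`, the current `K` maps onto both `S ⧸ m` and `S ⧸ M`, with nested and hence equal kernels. -/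
theorem exists_quotient_linearEquiv_of_inf_le {M : Submodule S S} (hM : IsCoatom M)
    (G : Finset {m : Submodule S S // IsCoatom m}) (K : Submodule S S) (hK : ¬K ≤ M)
    (hle : K ⊓ G.inf Subtype.val ≤ M) : ∃ m ∈ G, Nonempty ((S ⧸ m.1) ≃ₗ[S] (S ⧸ M)) := by
  classical
  induction G using Finset.induction_on generalizing K with
  | empty => exact absurd (by simpa using hle) hK
  | insert m G _ ih =>
    by_cases hm : K ⊓ m.1 ≤ M
    · refine ⟨m, by simp, ?_⟩
      have : IsSimpleModule S (S ⧸ m.1) := isSimpleModule_iff_isCoatom.2 m.2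
      have : IsSimpleModule S (S ⧸ M) := isSimpleModule_iff_isCoatom.2 hM
      have hsurj : ∀ I : Submodule S S, IsSimpleModule S (S ⧸ I) → ¬K ≤ I →
          Function.Surjective (I.mkQ ∘ₗ K.subtype) := by
        intro I _ hI
        refine LinearMap.surjective_of_ne_zero fun h0 => hI fun x hx => ?_
        rw [← Submodule.Quotient.mk_eq_zero I]
        exact LinearMap.congr_fun h0 ⟨x, hx⟩
      refine IsSimpleModule.nonempty_linearEquiv_of_ker_le
        (hsurj m.1 inferInstance fun h => hK ((le_inf le_rfl h).trans hm))
        (hsurj M inferInstance hK) fun x hx => ?_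
      have hx' : (x : S) ∈ m.1 := by simpa using hx
      simpa using hm ⟨x.2, hx'⟩
    · obtain ⟨m', hm', e⟩ := ih (K ⊓ m.1) hm (by rwa [Finset.inf_insert, ← inf_assoc] at hle)
      exact ⟨m', by simp [hm'], e⟩

/-- A minimal finite intersection of maximal left ideals lies in every maximal left ideal, so its
finitely many members represent all types. -/
theorem finite_simpleType_of_isArtinian [IsArtinian S S] : Finite (SimpleType S) := by
  classical
  obtain ⟨_, ⟨G, rfl⟩, hG⟩ := (wellFounded_lt (α := Submodule S S)).has_min
    (Set.range fun G : Finset {m : Submodule S S // IsCoatom m} => G.inf Subtype.val) ⟨_, ∅, rfl⟩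
  have key : ∀ i : SimpleType S, ∃ m : G, Nonempty ((S ⧸ m.1.1) ≃ₗ[S] i.Carrier) := by
    intro i
    have hi := (Quotient.out i).2
    have hle : G.inf Subtype.val ≤ (Quotient.out i).1 := by
      have h1 := hG _ ⟨insert (Quotient.out i) G, rfl⟩
      simp only [Finset.inf_insert] at h1
      by_contra hn
      exact h1 (inf_lt_right.2 hn)
    obtain ⟨m, hm, e⟩ := exists_quotient_linearEquiv_of_inf_le hi G ⊤
      (fun h => hi.1 (top_le_iff.1 h)) (by simpa using hle)
    exact ⟨⟨m, hm⟩, e⟩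
  choose m hm using key
  refine Finite.of_injective m fun i j hij => ?_
  obtain ⟨e⟩ := hm i
  obtain ⟨e'⟩ := hm j
  rw [hij] at e
  exact SimpleType.eq_of_linearEquiv (e.symm.trans e')

/-- Take a minimal projective cyclic left ideal with a nonzero map to the simple module. In any
decomposition one summand inherits the map, and by minimality it is everything. -/
theorem exists_isIndecomposable_surjective [IsArtinian S S] (j : SimpleType S) :
    ∃ A : Submodule S S, Module.IsIndecomposable S A ∧ Module.Projective S A ∧
      (∃ p : S →ₗ[S] A, Function.Surjective p) ∧
      ∃ π : A →ₗ[S] j.Carrier, Function.Surjective π := by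
  let X : Set (Submodule S S) := {A | Module.Projective S A ∧
    (∃ p : S →ₗ[S] A, Function.Surjective p) ∧ ∃ π : A →ₗ[S] j.Carrier, π ≠ 0}
  have hne : X.Nonempty := by
    refine ⟨⊤, .of_equiv' Submodule.topEquiv.symm, ⟨_, Submodule.topEquiv.symm.surjective⟩,
      (Quotient.out j).1.mkQ ∘ₗ Submodule.topEquiv.toLinearMap, fun h0 => ?_⟩
    obtain ⟨t, ht⟩ := @exists_ne _ (IsSimpleModule.nontrivial S j.Carrier) 0
    obtain ⟨s, rfl⟩ := Submodule.mkQ_surjective _ t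
    exact ht (LinearMap.congr_fun h0 ⟨s, trivial⟩)
  obtain ⟨A, ⟨hA, ⟨p, hp⟩, π, hπ⟩, hmin⟩ := (wellFounded_lt (α := Submodule S S)).has_min X hne
  have key : ∀ B C : Submodule S A, IsCompl B C → π ∘ₗ B.subtype ≠ 0 → C = ⊥ := by
    intro B C hBC hB
    let e := Submodule.equivMapOfInjective A.subtype A.subtype_injective B
    let q : A →ₗ[S] B := B.projectionOnto C hBC
    have hq : Function.Surjective q := fun b => ⟨b, Submodule.projectionOnto_apply_left hBC b⟩
    have hmem : B.map A.subtype ∈ X := by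
      have hB' : Module.Projective S B := Module.Projective.of_split B.subtype q
        (LinearMap.ext fun b => Submodule.projectionOnto_apply_left hBC b)
      refine ⟨.of_equiv' e, ⟨e.toLinearMap ∘ₗ q ∘ₗ p, e.surjective.comp (hq.comp hp)⟩,
        π ∘ₗ B.subtype ∘ₗ e.symm.toLinearMap, fun h0 => hB (LinearMap.ext fun b => ?_)⟩
      simpa using LinearMap.congr_fun h0 (e b)
    have hBtop : B = ⊤ := by
      have h1 : B.map A.subtype = A := by
        by_contra hne
        exact hmin _ hmem (lt_of_le_of_ne (Submodule.map_subtype_le _ _) hne)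
      refine Submodule.map_injective_of_injective A.subtype_injective ?_
      rw [h1, Submodule.map_subtype_top]
    simpa [hBtop] using hBC.inf_eq_bot
  refine ⟨A, ⟨?_, fun B C hBC => ?_⟩, hA, ⟨p, hp⟩, π, LinearMap.surjective_of_ne_zero hπ⟩
  · obtain ⟨a, ha⟩ := DFunLike.ne_iff.1 hπ
    exact ⟨a, 0, by rintro rfl; simp at ha⟩
  · by_cases hB : π ∘ₗ B.subtype = 0
    · by_cases hC : π ∘ₗ C.subtype = 0
      · refine absurd (LinearMap.ext fun a => ?_) hπ
        obtain ⟨b, hb, c, hc, rfl⟩ := Submodule.mem_sup.1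
          (hBC.sup_eq_top ▸ Submodule.mem_top : a ∈ B ⊔ C)
        have h1 : π b = 0 := LinearMap.congr_fun hB ⟨b, hb⟩
        have h2 : π c = 0 := LinearMap.congr_fun hC ⟨c, hc⟩
        rw [map_add, h1, h2, add_zero, LinearMap.zero_apply]
      · exact Or.inl (key C B hBC.symm hC)
    · exact Or.inr (key B C hBC hB)

/-- A cyclic module with an essential simple submodule embeds in any uniform strongly tight module
that contains the simple module. -/
theorem Module.IsStronglyTight.exists_injective {N P C : Type u} {T : Type u} [AddCommGroup N]
    [Module S N] [AddCommGroup P] [Module S P] [AddCommGroup C] [Module S C] [AddCommGroup T]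
    [Module S T] [IsSimpleModule S T] (hP : Module.IsStronglyTight S N P)
    (hU : Module.IsUniform S P) (p : N →ₗ[S] C) (hp : Function.Surjective p) (t : T →ₗ[S] C)
    (ht : t.IsEssentialEmbedding) (g : T →ₗ[S] P) (hg : g ≠ 0) :
    ∃ f : C →ₗ[S] P, Function.Injective f := by
  obtain ⟨E, _, _, κ, hE, hκ⟩ := Module.exists_injectiveHull S P
  -- The extension to `C` is injective because `T` is essential in `C`, and its image is essential
  -- because `E` is uniform.
  obtain ⟨k, hk⟩ := hE.out t ht.1 (κ ∘ₗ g)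
  have hg' : Function.Injective g := LinearMap.injective_of_ne_zero hg
  have hkinj : Function.Injective k := by
    refine LinearMap.injective_of_isEssentialIn ht.2 k ?_
    rintro _ ⟨x, rfl⟩ hx
    rw [hk] at hx
    have hx0 : x = 0 := (hκ.1.comp hg') (by simpa using hx)
    rw [hx0, map_zero]
  have hkess : k.IsEssentialEmbedding := by
    refine ⟨hkinj, (hU.of_essential κ hκ).isEssentialIn fun h0 => ?_⟩
    obtain ⟨x, hx⟩ := @exists_ne _ (IsSimpleModule.nontrivial S T) 0
    have hk0 : k (t x) = 0 := by rw [LinearMap.range_eq_bot.1 h0]; rfl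
    exact hx (ht.1 (hkinj (by simpa using hk0)))
  let e := p.quotKerEquivOfSurjective hp
  obtain ⟨f, hf⟩ := hP E κ ⟨hE, hκ⟩ (LinearMap.ker p) ⟨k ∘ₗ e.toLinearMap,
    hkinj.comp e.injective, by
      rw [LinearMap.range_comp, LinearEquiv.range, Submodule.map_top]; exact hkess.2⟩
  exact ⟨f ∘ₗ e.symm.toLinearMap, hf.comp e.symm.injective⟩

theorem exists_simpleType_of_isArtinian (X : Type v) [AddCommGroup X] [Module S X]
    [IsArtinian S X] [Nontrivial X] : ∃ j, j ∈ simpleTypes (S := S) X := by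
  obtain ⟨m, hm⟩ := IsAtomic.exists_atom (Submodule S X)
  have : IsSimpleModule S m := isSimpleModule_iff_isAtom.2 hm
  obtain ⟨j, ⟨e⟩⟩ := SimpleType.exists_linearEquiv (S := S) m
  refine ⟨j, m.subtype ∘ₗ e.symm.toLinearMap, fun h0 => ?_⟩
  obtain ⟨x, hx⟩ := @exists_ne _ (IsSimpleModule.nontrivial S j.Carrier) 0
  have := LinearMap.congr_fun h0 x
  exact hx (by simpa using this)

/-- Every simple module embeds in an indecomposable projective module. -/
theorem exists_projective_mem_simpleTypes [IsArtinian S S] {N : Type u} [AddCommGroup N]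
    [Module S N] (eN : S ≃ₗ[S] N)
    (H : ∀ (P : Type u) [AddCommGroup P] [Module S P], Module.Projective S P →
      Module.IsIndecomposable S P → Module.IsUniform S P ∧ Module.IsStronglyTight S N P)
    (j : SimpleType S) : ∃ A : Submodule S S, Module.Projective S A ∧
      Module.IsIndecomposable S A ∧ j ∈ simpleTypes (S := S) A := by
  have : IsArtinianRing S := inferInstanceAs (IsArtinian S S)
  choose A hAll using fun j : SimpleType S => exists_isIndecomposable_surjective j
  have hA := fun j => (hAll j).1
  have hP := fun j => (hAll j).2.1
  choose p hp using fun j => (hAll j).2.2.1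
  choose π hπ using fun j => (hAll j).2.2.2
  have hU := fun j => (H (A j) (hP j) (hA j)).1
  choose ψ g hg using fun j =>
    have := (hA j).1
    exists_simpleType_of_isArtinian (S := S) (A j)
  have hess : ∀ j, (g j).IsEssentialEmbedding := fun j =>
    ⟨LinearMap.injective_of_ne_zero (hg j), (hU j).isEssentialIn (mt LinearMap.range_eq_bot.1 (hg j))⟩
  have hemb : ∀ j k, ψ j = ψ k → ∃ f : A j →ₗ[S] A k, Function.Injective f := by
    intro j k hjk
    obtain ⟨g', hg'⟩ : ∃ g' : (ψ j).Carrier →ₗ[S] A k, g' ≠ 0 := hjk ▸ ⟨g k, hg k⟩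
    exact (H (A k) (hP k) (hA k)).2.exists_injective (hU k) (p j ∘ₗ eN.symm.toLinearMap)
      ((hp j).comp eN.symm.surjective) (g j) (hess j) g' hg'
  -- Equal socles give embeddings both ways. By the artinian condition `A k` then maps onto `A j`,
  -- and its simple quotient is unique.
  have hψ : Function.Injective ψ := by
    intro j k hjk
    obtain ⟨f, hf⟩ := hemb j k hjk
    obtain ⟨f', hf'⟩ := hemb k j hjk.symm
    have hsurj : Function.Surjective (f' ∘ₗ f) :=
      IsArtinian.surjective_of_injective_endomorphism _ (hf'.comp hf)
    have hsurj' : Function.Surjective f' := Function.Surjective.of_comp hsurj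
    obtain ⟨e⟩ := (hA k).nonempty_linearEquiv_of_surjective (π := π j ∘ₗ f')
      ((hπ j).comp hsurj') (hπ k)
    exact SimpleType.eq_of_linearEquiv e
  have := finite_simpleType_of_isArtinian (S := S)
  obtain ⟨i, rfl⟩ := Finite.surjective_of_injective hψ j
  exact ⟨A i, hP i, hA i, g i, hg i⟩

/-- The homomorphisms from a cyclic module to indecomposable projective modules separate
points. -/
theorem exists_linearMap_ne_zero [IsArtinian S S] {N : Type u} [AddCommGroup N]
    [Module S N] (eN : S ≃ₗ[S] N) (A : SimpleType S → Submodule S S)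
    (hU : ∀ j, Module.IsUniform S (A j)) (hT : ∀ j, Module.IsStronglyTight S N (A j))
    (hA : ∀ j, j ∈ simpleTypes (S := S) (A j)) {C : Type u} [AddCommGroup C] [Module S C]
    (p : S →ₗ[S] C) (hp : Function.Surjective p) {x : C} (hx : x ≠ 0) :
    ∃ (j : SimpleType S) (h : C →ₗ[S] A j), h x ≠ 0 := by
  have : IsArtinian S C := isArtinian_of_surjective _ p hp
  have : Nontrivial (Submodule.span S {x}) := by
    rw [Submodule.nontrivial_iff_ne_bot]; simpa using hx
  obtain ⟨j, t', ht'⟩ := exists_simpleType_of_isArtinian (S := S) (Submodule.span S {x})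
  let t : j.Carrier →ₗ[S] C := (Submodule.span S {x}).subtype ∘ₗ t'
  have ht : Function.Injective t :=
    (Submodule.subtype_injective _).comp (LinearMap.injective_of_ne_zero ht')
  -- Modulo a maximal `I` avoiding a simple submodule of the span of `x`, that simple becomes
  -- essential, so tightness embeds `C ⧸ I` in `A j`.
  obtain ⟨I, hI, hmax⟩ := Submodule.exists_maximal_inf_eq_bot (LinearMap.range t)
  have hzero : ∀ a, t a ∈ I → a = 0 := fun a ha => ht (by
    have : t a ∈ I ⊓ LinearMap.range t := ⟨ha, a, rfl⟩
    rw [hI, Submodule.mem_bot] at this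
    rw [this, map_zero])
  have hess : (I.mkQ ∘ₗ t).IsEssentialEmbedding := by
    constructor
    · rw [← LinearMap.ker_eq_bot, eq_bot_iff]
      intro a ha
      exact hzero a ((Submodule.Quotient.mk_eq_zero I).1 ha)
    · intro L hL
      have h1 : L.comap I.mkQ ≤ I := by
        refine hmax ?_ fun z hz => ?_
        · change L.comap I.mkQ ⊓ LinearMap.range t = ⊥
          rw [eq_bot_iff]
          rintro _ ⟨hz, a, rfl⟩
          have : I.mkQ (t a) ∈ LinearMap.range (I.mkQ ∘ₗ t) ⊓ L := ⟨⟨a, rfl⟩, hz⟩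
          rw [hL, Submodule.mem_bot] at this
          rw [hzero a ((Submodule.Quotient.mk_eq_zero I).1 this), map_zero]
          exact Submodule.zero_mem _
        · have : I.mkQ z = 0 := (Submodule.Quotient.mk_eq_zero I).2 hz
          rw [Submodule.mem_comap, this]
          exact L.zero_mem
      rw [eq_bot_iff]
      intro y hy
      obtain ⟨z, rfl⟩ := I.mkQ_surjective y
      exact (Submodule.Quotient.mk_eq_zero I).2 (h1 hy)
  obtain ⟨g, hg⟩ := hA j
  obtain ⟨k, hk⟩ := (hT j).exists_injective (hU j) (I.mkQ ∘ₗ p ∘ₗ eN.symm.toLinearMap)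
    (I.mkQ_surjective.comp (hp.comp eN.symm.surjective)) (I.mkQ ∘ₗ t) hess g hg
  refine ⟨j, k ∘ₗ I.mkQ, fun h0 => ?_⟩
  have hxI : x ∈ I := (Submodule.Quotient.mk_eq_zero I).1 (hk (h0.trans (map_zero k).symm))
  obtain ⟨a, ha⟩ := @exists_ne _ (IsSimpleModule.nontrivial S j.Carrier) 0
  exact ha (hzero a ((Submodule.span_singleton_le_iff_mem x I).2 hxI (t' a).2))

/-- An artinian module whose homomorphisms to the uniform modules `A j` separate points
essentially embeds in a finite product of these modules. -/
theorem exists_isEssentialEmbedding_pi {C : Type v} [AddCommGroup C] [Module S C] [IsArtinian S C]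
    {ι : Type w} (A : ι → Type*) [∀ j, AddCommGroup (A j)] [∀ j, Module S (A j)]
    (hU : ∀ j, Module.IsUniform S (A j))
    (hsep : ∀ x : C, x ≠ 0 → ∃ (j : ι) (h : C →ₗ[S] A j), h x ≠ 0) :
    ∃ (G : Finset (Σ j, C →ₗ[S] A j)) (f : C →ₗ[S] ∀ g : G, A g.1.1), f.IsEssentialEmbedding := by
  classical
  let K : Finset (Σ j, C →ₗ[S] A j) → Submodule S C := fun G => G.inf fun g => LinearMap.ker g.2
  have hex : ∃ G, K G = ⊥ := by
    obtain ⟨_, ⟨G, rfl⟩, hG⟩ := (wellFounded_lt (α := Submodule S C)).has_min (Set.range K)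
      ⟨_, ∅, rfl⟩
    refine ⟨G, eq_bot_iff.2 fun x hx => ?_⟩
    by_contra hx0
    obtain ⟨j, h, hh⟩ := hsep x hx0
    refine hG _ ⟨insert ⟨j, h⟩ G, rfl⟩ ?_
    simp only [K, Finset.inf_insert]
    exact inf_lt_right.2 fun hle => hh (hle hx)
  -- By minimality the common kernel of the maps other than `g` has nonzero image under `g`,
  -- essential in the uniform factor. The image of `C` contains the product of these images.
  obtain ⟨G, hG, hmin⟩ := (wellFounded_lt (α := Finset (Σ j, C →ₗ[S] A j))).has_min
    {G | K G = ⊥} hex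
  refine ⟨G, LinearMap.pi fun g => g.1.2, ?_, ?_⟩
  · rw [← LinearMap.ker_eq_bot, eq_bot_iff, ← hG]
    intro x hx
    simp only [K, Submodule.mem_finsetInf]
    exact fun g hg => congrFun (LinearMap.mem_ker.1 hx) ⟨g, hg⟩
  · refine (Submodule.isEssentialIn_pi (fun g : G => (K (G.erase g)).map g.1.2) fun g =>
      (hU g.1.1).isEssentialIn fun h0 => ?_).mono fun y hy => ?_
    · refine hmin (G.erase g) (eq_bot_iff.2 ?_) (Finset.erase_ssubset g.2)
      rw [← hG]
      conv_rhs => rw [← Finset.insert_erase g.2]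
      simp only [K, Finset.inf_insert]
      exact le_inf (LinearMap.le_ker_iff_map.2 h0) le_rfl
    · choose c hc hcy using fun g => hy g (Set.mem_univ g)
      refine ⟨∑ g, c g, funext fun g => ?_⟩
      rw [LinearMap.pi_apply, map_sum, Finset.sum_eq_single g, hcy]
      · intro g' _ hne
        have h1 := hc g'
        simp only [K, SetLike.mem_coe, Submodule.mem_finsetInf] at h1
        exact h1 g (Finset.mem_erase.2 ⟨fun h => hne (Subtype.ext h.symm), g.2⟩)
      · simp

theorem cyclicsEssentiallyEmbed_of_isArtinian [IsArtinian S S] {N : Type u} [AddCommGroup N]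
    [Module S N] (eN : S ≃ₗ[S] N)
    (H : ∀ (P : Type u) [AddCommGroup P] [Module S P], Module.Projective S P →
      Module.IsIndecomposable S P → Module.IsUniform S P ∧ Module.IsStronglyTight S N P) :
    CyclicsEssentiallyEmbed S := by
  classical
  intro C _ _ ⟨c, hc⟩
  choose A hP hI hA using exists_projective_mem_simpleTypes eN H
  have hp : Function.Surjective (LinearMap.toSpanSingleton S C c) := by
    rw [← LinearMap.range_eq_top, LinearMap.range_toSpanSingleton, hc]
  have : IsArtinian S C := isArtinian_of_surjective _ _ hp
  obtain ⟨G, f, hf⟩ := exists_isEssentialEmbedding_pi (fun j => A j)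
    (fun j => (H (A j) (hP j) (hI j)).1) fun x hx => exists_linearMap_ne_zero eN A
      (fun j => (H (A j) (hP j) (hI j)).1) (fun j => (H (A j) (hP j) (hI j)).2) hA _ hp hx
  exact ⟨∀ g : G, A g.1.1, inferInstance, inferInstance,
    .of_equiv' (DFinsupp.linearEquivFunOnFintype (R := S) (M := fun g : G => A g.1.1)), f, hf⟩

end Converse

/-- The ring of right operators is the regular right module. -/
def MulOpposite.rightRegularEquiv (R : Type u) [Ring R] : Rᵐᵒᵖ ≃ₗ[Rᵐᵒᵖ] R where
  toFun := MulOpposite.unop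
  invFun := MulOpposite.op
  map_add' _ _ := rfl
  map_smul' _ _ := rfl
  left_inv _ := rfl
  right_inv _ := rfl

theorem theorem4p12 (R : Type u) [Ring R] :
    IsCEPRing R ↔
      IsArtinian Rᵐᵒᵖ R ∧
        ∀ (P : Type u) [AddCommGroup P] [Module Rᵐᵒᵖ P],
          Module.Projective Rᵐᵒᵖ P → Module.IsIndecomposable Rᵐᵒᵖ P →
            Module.IsUniform Rᵐᵒᵖ P ∧ Module.IsStronglyTight Rᵐᵒᵖ R P := by
  let e := MulOpposite.rightRegularEquiv R
  constructor
  · intro h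
    -- The two conditions agree definitionally.
    have h' : CyclicsEssentiallyEmbed Rᵐᵒᵖ := h
    have := h'.isArtinian
    exact ⟨isArtinian_of_linearEquiv e, fun P _ _ hP hI => h'.isUniform_and_isStronglyTight e hP hI⟩
  · rintro ⟨h, H⟩
    have : IsArtinian Rᵐᵒᵖ Rᵐᵒᵖ := isArtinian_of_linearEquiv e.symm
    exact cyclicsEssentiallyEmbed_of_isArtinian e H
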